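/- Let $(R,\mathfrak m,k)$ be a one-dimensional Noetherian local domain with infinite residue field $k$ and quotient field $K$. Assume that the integral closure $\overline R$ of $R$ in $K$ is a finite $R$-module and a discrete valuation ring, and that the natural map from $k$ to the residue field of $\overline R$ is an isomorphism. For $R$-submodules $A,B$ of $K$ put $A:B=\{x\in K \mid xB\subseteq A\}$ and $A^{**}=R:(R:A)$. Let $\omega$ be a canonical module of $R$ (that is, a finitely generated $R$-module with $\operatorname{Ext}^1_R(k,\omega)\cong k$ and $\operatorname{Ext}^i_R(k,\omega)=0$ for $i\neq 1$), chosen as an $R$-submodule of $K$ with $R\subseteq\omega\subseteq\overline R$. Let $I$ be an $\mathfrak m$-primary ideal of $R$ which is not principal, let $\Lambda=\bigcup_{n\ge 0}(I^n:I^n)$ be the blowing-up of $R$ along $I$, and let $\nu$ be the reduction exponent of $I$, i.e. the least integer $m$ such that for some $x\in I$ one has $I^{n+1}=xI^n$ for all $n\ge m$. For an ideal $J$ of $R$ let $\widetilde J=J\omega\cap R$ be its canonical closure. Then: (A) The following conditions are equivalent: $(A_1)$ $\omega\subseteq\Lambda$; $(A_2)$ $\omega\Lambda=\Lambda$; $(A_3)$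 $\omega:\Lambda=R:\Lambda$; $(A_4)$ $I^n=\widetilde{I^n}$ for all $n\ge\nu$; $(A_5)$ $\omega I^n=I^n$ for all $n\ge\nu$; $(A_6)$ there exists $n>0$ such that $\omega I^n=I^n$. (B) The following conditions are equivalent: $(B_1)$ $\Lambda=\Lambda^{**}$; $(B_2)$ $\omega:\Lambda=\omega(R:\Lambda)$. Moreover, the conditions (A) hold if and only if the conditions (B) hold and $R:\Lambda\subseteq R:\omega$. -/

import Mathlib

universe u

noncomputable section

/-- A canonical module of a Noetherian (Cohen-Macaulay) local ring `(R, 𝔪, k)` of dimension `d`: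
a finitely generated module `M` with `Extⁱ(k, M) ≅ k` for `i = d` and `Extⁱ(k, M) = 0` for
`i ≠ d`. -/
structure IsCanonicalModule (R : Type u) [CommRing R] [IsLocalRing R]
    (M : Type u) [AddCommGroup M] [Module R M] : Prop where
  finite : Module.Finite R M
  ext_dim : ∀ i : ℕ, (i : WithBot ℕ∞) = ringKrullDim R →
    Nonempty (CategoryTheory.Abelian.Ext (ModuleCat.of R (IsLocalRing.ResidueField R))
      (ModuleCat.of R M) i ≃ₗ[R] IsLocalRing.ResidueField R)
  ext_ne_dim : ∀ i : ℕ, (i : WithBot ℕ∞) ≠ ringKrullDim R →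
    Subsingleton (CategoryTheory.Abelian.Ext (ModuleCat.of R (IsLocalRing.ResidueField R))
      (ModuleCat.of R M) i)

/-- Residual rationality of `R` inside a local `R`-algebra `S`: the natural map from `R`, hence
from the residue field of `R`, onto the residue field of `S` is surjective. -/
def IsResiduallyRational (R S : Type*) [CommRing R] [CommRing S] [IsLocalRing S]
    [Algebra R S] : Prop :=
  Function.Surjective ((IsLocalRing.residue S).comp (algebraMap R S))

section Blowup

variable {R : Type*} [CommRing R] (K : Type*) [Field K] [Algebra R K]

open IsLocalization (coeSubmodule)

/-- The blowing-up `Λ(I) = ⋃ₙ (Iⁿ : Iⁿ)`, as an `R`-submodule of `K`. Here, for submodules of `K`,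
`A / B` is the colon `A : B = {x ∈ K | x B ⊆ A}`. The supremum is the union, see
`mem_blowup_iff`. -/
def blowup (I : Ideal R) : Submodule R K :=
  ⨆ n : ℕ, coeSubmodule K (I ^ n) / coeSubmodule K (I ^ n)

theorem mem_blowup_iff (I : Ideal R) (z : K) :
    z ∈ blowup K I ↔ ∃ n : ℕ, z ∈ coeSubmodule K (I ^ n) / coeSubmodule K (I ^ n) := by
  have hmono : Monotone fun n : ℕ => coeSubmodule K (I ^ n) / coeSubmodule K (I ^ n) := by
    refine monotone_nat_of_le_succ fun n z hz => ?_
    rw [Submodule.mem_div_iff_forall_mul_mem] at hz ⊢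
    intro y hy
    rw [pow_succ, IsLocalization.coeSubmodule_mul] at hy ⊢
    refine Submodule.mul_induction_on hy (fun a ha b hb => ?_) fun a b ha hb => ?_
    · rw [← mul_assoc]
      exact Submodule.mul_mem_mul (hz a ha) hb
    · rw [mul_add]
      exact add_mem ha hb
  exact Submodule.mem_iSup_of_directed _ hmono.directed_le

/-- The canonical closure `J ω ∩ R` of an ideal `J` of `R`, as an ideal of `R`. -/
def canonicalClosure (ω : Submodule R K) (J : Ideal R) : Ideal R :=
  (coeSubmodule K J * ω).comap (Algebra.linearMap R K)

end Blowup

/-- The reduction exponent `ν(I)`: the least `m` such that, for a minimal reduction `x ∈ I`,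
`Iⁿ⁺¹ = x Iⁿ` for all `n ≥ m`. It does not depend on `x`, see `reductionExponent_eq`. -/
def reductionExponent {R : Type*} [CommRing R] (I : Ideal R) : ℕ :=
  sInf {m : ℕ | ∃ x ∈ I, ∀ n ≥ m, I ^ (n + 1) = Ideal.span {x} * I ^ n}

/-- Any minimal reduction `x` of `I` computes the reduction exponent. -/
theorem reductionExponent_eq {R : Type*} [CommRing R] [IsDomain R] {I : Ideal R} (hI : I ≠ ⊥)
    {x : R} (hx : x ∈ I) (hred : ∃ N, ∀ n ≥ N, I ^ (n + 1) = Ideal.span {x} * I ^ n) :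
    reductionExponent I = sInf {m : ℕ | ∀ n ≥ m, I ^ (n + 1) = Ideal.span {x} * I ^ n} := by
  unfold reductionExponent
  congr 1
  ext m
  refine ⟨?_, fun h => ⟨x, hx, h⟩⟩
  rintro ⟨y, -, hym⟩ n hn
  obtain ⟨N, hN⟩ := hred
  have hy0 : y ≠ 0 := by
    rintro rfl
    have h := hym m le_rfl
    rw [Ideal.span_singleton_zero, Ideal.bot_mul] at h
    exact hI (eq_bot_iff.2 (pow_eq_zero_iff (Nat.succ_ne_zero m) |>.1 h).le)
  have key : ∀ j k, m ≤ k → I ^ (k + j) = Ideal.span {y ^ j} * I ^ k := by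
    intro j k hk
    induction j with
    | zero => simp
    | succ j ih =>
      rw [← add_assoc, hym _ (by omega), ih, ← mul_assoc, Ideal.span_singleton_mul_span_singleton,
        ← pow_succ']
  have h := hN (n + N) (by omega)
  rw [show n + N + 1 = (n + 1) + N by ring, key N (n + 1) (by omega), key N n hn, ← mul_assoc,
    mul_comm (Ideal.span {x}), mul_assoc] at h
  exact (Ideal.span_singleton_mul_right_inj (pow_ne_zero N hy0)).1 h

end

/-! Everything rests on the duality `ω : (ω : A) = A` for nonzero `A` inside the integral closure
(`IsCanonicalModule.div_div_eq`), and on `Iⁿ = xⁿΛ` for `n ≥ ν`, where `x` is a reduction of `I`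
(`coeSubmodule_pow_eq_span_mul_blowup`). Duality with `A = R` gives `ω : ω = R`, hence `ω : ωA = R :
A`; the equivalences then become colon arithmetic, with `Iⁿ` replaced by `Λ` up to the factor `xⁿ`.
For the duality, `Ext¹(k, ω) ≅ k` bounds the socle of `K/ω` by one dimension, so `ω : -` carries a
step with quotient `0` or `k` to another such step. Reflexivity therefore climbs from a multiple of
`ω` inside `A` up to `A`. -/

/-! ### Obstructions in `Ext¹(k, M)`. -/

-- By the long exact sequence of `0 → 𝔪 → R → k → 0`, the obstruction to extending a map from `𝔪` to
-- `R` lies in `Ext¹(k, M) ≅ k`. That of `φ` is nonzero, so that of `ψ` is a multiple of it.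
open CategoryTheory IsLocalRing in
theorem exists_extension_sub_smul {R M : Type u} [CommRing R] [IsLocalRing R]
    [AddCommGroup M] [Module R M]
    (e : Abelian.Ext (ModuleCat.of R (ResidueField R)) (ModuleCat.of R M) 1 ≃ₗ[R] ResidueField R)
    (φ ψ : maximalIdeal R →ₗ[R] M) (hφ : ¬ ∃ φ' : R →ₗ[R] M, ∀ a : maximalIdeal R, φ' a = φ a) :
    ∃ (r : R) (ψ' : R →ₗ[R] M), ∀ a : maximalIdeal R, ψ' a = ψ a - r • φ a := by
  let S : ShortComplex (ModuleCat.{u} R) :=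
    ModuleCat.shortComplexOfCompEqZero (maximalIdeal R).subtype
      (Algebra.linearMap R (ResidueField R))
      (by ext a; simp)
  have hS : S.ShortExact := by
    refine ModuleCat.shortComplex_shortExact S ?_ (Submodule.injective_subtype _)
      residue_surjective
    intro a
    simp [S]
  have key : ∀ χ : maximalIdeal R →ₗ[R] M,
      hS.extClass.comp (Abelian.Ext.mk₀ (ModuleCat.ofHom χ)) (add_zero 1) = 0 →
      ∃ χ' : R →ₗ[R] M, ∀ a : maximalIdeal R, χ' a = χ a := by
    intro χ h
    obtain ⟨x, hx⟩ := Abelian.Ext.contravariant_sequence_exact₁ hS _ _ _ h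
    obtain ⟨y, rfl⟩ := Abelian.Ext.homEquiv₀.symm.surjective x
    rw [Abelian.Ext.homEquiv₀_symm_apply, Abelian.Ext.mk₀_comp_mk₀] at hx
    have := Abelian.Ext.homEquiv₀.symm.injective hx
    exact ⟨y.hom, fun a => congrArg (fun t => t.hom a) this⟩
  let δ : (maximalIdeal R →ₗ[R] M) → ResidueField R := fun χ =>
    e (hS.extClass.comp (Abelian.Ext.mk₀ (ModuleCat.ofHom χ)) (add_zero 1))
  have hφ0 : δ φ ≠ 0 := fun h => hφ (key φ (e.map_eq_zero_iff.1 h))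
  obtain ⟨r, hr⟩ := residue_surjective (δ ψ / δ φ)
  obtain ⟨ψ', hψ'⟩ := key (ψ + (-r) • φ) (by
    apply e.injective
    have h : ModuleCat.ofHom (ψ + (-r) • φ) = ModuleCat.ofHom ψ + (-r) • ModuleCat.ofHom φ := rfl
    rw [h, Abelian.Ext.mk₀_add, Abelian.Ext.mk₀_smul, Abelian.Ext.comp_add,
      Abelian.Ext.comp_smul, map_add, map_smul, map_zero, neg_smul, Algebra.smul_def,
      ResidueField.algebraMap_eq, hr, ← sub_eq_add_neg]
    exact sub_eq_zero.2 (div_mul_cancel₀ _ hφ0).symm)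
  exact ⟨r, ψ', fun a => by simp [hψ', sub_eq_add_neg]⟩

/-! ### Formal rules for colons. -/

section Colon

variable {R K : Type*} [CommRing R] [Field K] [Algebra R K]

theorem Submodule.div_anti (ω : Submodule R K) {A B : Submodule R K} (h : A ≤ B) :
    ω / B ≤ ω / A := fun _ hz =>
  Submodule.mem_div_iff_forall_mul_mem.2 fun y hy =>
    Submodule.mem_div_iff_forall_mul_mem.1 hz y (h hy)

theorem Submodule.le_div_div (ω A : Submodule R K) : A ≤ ω / (ω / A) := by
  rw [Submodule.le_div_iff_mul_le, mul_comm, ← Submodule.le_div_iff_mul_le]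

theorem Submodule.div_mul_eq_div_div (A B C : Submodule R K) : A / (B * C) = (A / B) / C :=
  eq_of_forall_le_iff fun D => by
    simp only [Submodule.le_div_iff_mul_le, mul_assoc, mul_comm B C]

end Colon

/-! ### Duality with respect to `ω`. -/

section Duality

open IsLocalRing

variable {R K : Type u} [CommRing R] [IsLocalRing R] [Field K] [Algebra R K]

theorem maximalIdeal_ne_bot_of_ringKrullDim_eq_one {R : Type*} [CommRing R] [IsLocalRing R]
    (hdim : ringKrullDim R = 1) : maximalIdeal R ≠ ⊥ := fun h => by
  have := ringKrullDim_eq_zero_of_isField (isField_iff_maximalIdeal_eq.2 h)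
  simp [hdim] at this

/-- The socle of `K/ω` is at most one-dimensional: a socle element `f` gives `a ↦ a • f` from `𝔪` to
`ω`, which extends to `R` only if `f ∈ ω`. -/
theorem IsCanonicalModule.exists_sub_smul_mem [IsFractionRing R K] (hdim : ringKrullDim R = 1)
    {ω : Submodule R K} (hω : IsCanonicalModule R ω) {f g : K}
    (hf : ∀ a ∈ maximalIdeal R, a • f ∈ ω) (hg : ∀ a ∈ maximalIdeal R, a • g ∈ ω) (hfω : f ∉ ω) :
    ∃ r : R, g - r • f ∈ ω := by
  obtain ⟨e⟩ := hω.ext_dim 1 (by simp [hdim])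
  obtain ⟨b, hb, hb0⟩ : ∃ b ∈ maximalIdeal R, b ≠ 0 :=
    Submodule.exists_mem_ne_zero_of_ne_bot (maximalIdeal_ne_bot_of_ringKrullDim_eq_one hdim)
  have hbK : algebraMap R K b ≠ 0 := by simpa using hb0
  have cancel : ∀ (χ : R →ₗ[R] ω) (z : K), (χ b : K) = b • z → z ∈ ω := by
    intro χ z h
    have h1 : χ b = b • χ 1 := by rw [← map_smul, smul_eq_mul, mul_one]
    rw [h1, Submodule.coe_smul, Algebra.smul_def, Algebra.smul_def] at h
    rw [← mul_left_cancel₀ hbK h]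
    exact (χ 1).2
  let mulBy (z : K) (hz : ∀ a ∈ maximalIdeal R, a • z ∈ ω) : maximalIdeal R →ₗ[R] ω :=
    (LinearMap.toSpanSingleton R K z).restrict hz
  obtain ⟨r, ψ, hψ⟩ := exists_extension_sub_smul e (mulBy f hf) (mulBy g hg) (by
    rintro ⟨φ, hφ⟩
    exact hfω (cancel φ f (congrArg Subtype.val (hφ ⟨b, hb⟩))))
  refine ⟨r, cancel ψ _ ((congrArg Subtype.val (hψ ⟨b, hb⟩)).trans ?_)⟩
  change b • g - r • b • f = b • (g - r • f)
  rw [smul_sub, smul_comm]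

/-- `B` is generated over `A` by one element that `𝔪` multiplies into `A`, i.e. `B / A` is zero or
isomorphic to the residue field. -/
def IsSimpleStep (A B : Submodule R K) : Prop :=
  ∃ b : K, (∀ a ∈ maximalIdeal R, a • b ∈ A) ∧ B = A ⊔ Submodule.span R {b}

theorem IsSimpleStep.le {A B : Submodule R K} (h : IsSimpleStep A B) : A ≤ B := by
  obtain ⟨b, -, rfl⟩ := h
  exact le_sup_left

/-- Multiplication by `b` maps `ω : A` to the socle of `K/ω`, with kernel `ω : B`. -/
theorem IsSimpleStep.div [IsFractionRing R K] (hdim : ringKrullDim R = 1)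
    {ω : Submodule R K} (hω : IsCanonicalModule R ω) {A B : Submodule R K}
    (h : IsSimpleStep A B) : IsSimpleStep (ω / B) (ω / A) := by
  have hle := Submodule.div_anti ω h.le
  obtain ⟨b, hb, rfl⟩ := h
  have mem_iff : ∀ z ∈ ω / A, z * b ∈ ω → z ∈ ω / (A ⊔ Submodule.span R {b}) := by
    intro z hz hzb
    rw [Submodule.mem_div_iff_forall_mul_mem] at hz ⊢
    intro y hy
    obtain ⟨a, ha, c, hc, rfl⟩ := Submodule.mem_sup.1 hy
    obtain ⟨r, rfl⟩ := Submodule.mem_span_singleton.1 hc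
    rw [mul_add, mul_smul_comm]
    exact add_mem (hz a ha) (ω.smul_mem r hzb)
  have socle : ∀ z ∈ ω / A, ∀ a ∈ maximalIdeal R, a • (z * b) ∈ ω := by
    intro z hz a ha
    rw [← mul_smul_comm]
    exact Submodule.mem_div_iff_forall_mul_mem.1 hz _ (hb a ha)
  by_cases hall : ∀ z ∈ ω / A, z * b ∈ ω
  · refine ⟨0, by simp, ?_⟩
    simpa using le_antisymm (fun z hz => mem_iff z hz (hall z hz)) hle
  · push Not at hall
    obtain ⟨f, hf, hfb⟩ := hall
    refine ⟨f, fun a ha => mem_iff _ ((ω / A).smul_mem a hf) ?_, le_antisymm (fun g hg => ?_) ?_⟩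
    · rw [smul_mul_assoc]
      exact socle f hf a ha
    · obtain ⟨r, hr⟩ := hω.exists_sub_smul_mem hdim (socle f hf) (socle g hg) hfb
      rw [← sub_add_cancel g (r • f)]
      refine add_mem (Submodule.mem_sup_left (mem_iff _ (sub_mem hg (Submodule.smul_mem _ r hf)) ?_))
        (Submodule.mem_sup_right (Submodule.mem_span_singleton.2 ⟨r, rfl⟩))
      rwa [sub_mul, smul_mul_assoc]
    · exact sup_le hle (by simpa using hf)

/-- Dualizing twice, `A ⊆ ω : (ω : B)` is again a simple step, and `B` lies in between; so `B` fills
it unless `B = A`. -/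
theorem IsSimpleStep.div_div_eq [IsFractionRing R K] (hdim : ringKrullDim R = 1)
    {ω : Submodule R K} (hω : IsCanonicalModule R ω) {A B : Submodule R K}
    (h : IsSimpleStep A B) (hA : ω / (ω / A) = A) : ω / (ω / B) = B := by
  refine le_antisymm ?_ (Submodule.le_div_div ω B)
  have hle := Submodule.le_div_div ω B
  obtain ⟨g, hg, hgB⟩ := (h.div hdim hω).div hdim hω
  rw [hA] at hg hgB
  obtain ⟨b, hb, rfl⟩ := h
  by_cases hbA : b ∈ A
  · rw [sup_eq_left.2 (by simpa using hbA), hA]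
  rw [hgB] at hle ⊢
  obtain ⟨a, ha, c, hc, hac⟩ :=
    Submodule.mem_sup.1 (hle (Submodule.mem_sup_right (Submodule.mem_span_singleton_self b)))
  obtain ⟨r, rfl⟩ := Submodule.mem_span_singleton.1 hc
  have hr : IsUnit r := by
    by_contra hr
    exact hbA (hac ▸ add_mem ha (hg r ((mem_maximalIdeal r).2 hr)))
  obtain ⟨u, rfl⟩ := hr
  refine sup_le le_sup_left ?_
  rw [Submodule.span_singleton_le_iff_mem]
  have hgab : g = (↑u⁻¹ : R) • (b - a) := by
    rw [← hac, add_sub_cancel_left, smul_smul, Units.inv_mul, one_smul]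
  rw [hgab]
  exact Submodule.smul_mem _ _ (sub_mem
    (Submodule.mem_sup_right (Submodule.mem_span_singleton_self b)) (Submodule.mem_sup_left ha))

theorem IsCanonicalModule.div_div_eq_of_le [IsFractionRing R K] (hdim : ringKrullDim R = 1)
    {ω : Submodule R K} (hω : IsCanonicalModule R ω) {A B : Submodule R K} [IsNoetherian R B]
    (hAB : A ≤ B) (hn : ∃ n : ℕ, ∀ a ∈ maximalIdeal R ^ n, ∀ z ∈ B, a • z ∈ A)
    (hA : ω / (ω / A) = A) : ω / (ω / B) = B := by
  obtain ⟨D, ⟨hAD, hD⟩, hmax⟩ := set_has_maximal_iff_noetherian.2 ‹IsNoetherian R B›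
    {D : Submodule R B | A ≤ D.map B.subtype ∧
      ω / (ω / D.map B.subtype) = D.map B.subtype}
    ⟨A.comap B.subtype, by
      rw [Set.mem_ofPred_eq, Submodule.map_comap_subtype, inf_eq_right.2 hAB]
      exact ⟨le_rfl, hA⟩⟩
  set C := D.map B.subtype with hC
  by_cases hBC : B ≤ C
  · rwa [le_antisymm (hC ▸ Submodule.map_subtype_le B D) hBC] at hD
  exfalso
  classical
  -- With `k + 1` the least exponent killing `B/C`, an element of `𝔪ᵏB` outside `C` enlarges the
  -- maximal reflexive `C` by a simple step.
  have hex : ∃ n : ℕ, ∀ a ∈ maximalIdeal R ^ n, ∀ z ∈ B, a • z ∈ C :=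
    hn.imp fun n h a ha z hz => hAD (h a ha z hz)
  obtain ⟨k, hk⟩ : ∃ k, Nat.find hex = k + 1 := by
    refine Nat.exists_eq_succ_of_ne_zero fun h0 => hBC fun z hz => ?_
    have := Nat.find_spec hex
    rw [h0] at this
    simpa using this 1 (by simp) z hz
  have hlt := Nat.find_min hex (m := k) (by omega)
  have hspec := Nat.find_spec hex
  rw [hk] at hspec
  push Not at hlt
  obtain ⟨a, ha, z, hz, haz⟩ := hlt
  have hmap : (D ⊔ Submodule.span R {⟨a • z, B.smul_mem a hz⟩}).map B.subtype =
      C ⊔ Submodule.span R {a • z} := by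
    rw [Submodule.map_sup, Submodule.map_span, Set.image_singleton]
    rfl
  refine hmax (D ⊔ Submodule.span R {⟨a • z, B.smul_mem a hz⟩}) ?_ (lt_of_le_of_ne le_sup_left ?_)
  · rw [Set.mem_ofPred_eq, hmap]
    refine ⟨hAD.trans le_sup_left, IsSimpleStep.div_div_eq hdim hω ⟨a • z, fun c hc => ?_, rfl⟩ hD⟩
    rw [smul_smul]
    exact hspec _ (pow_succ' (maximalIdeal R) k ▸ Ideal.mul_mem_mul hc ha) z hz
  · intro h
    rw [← h] at hmap
    exact haz (hmap.ge (Submodule.mem_sup_right (Submodule.mem_span_singleton_self _)))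

theorem exists_maximalIdeal_pow_le_of_ne_bot [IsDomain R] [IsNoetherianRing R]
    (hdim : ringKrullDim R = 1) {J : Ideal R} (hJ : J ≠ ⊥) : ∃ n, maximalIdeal R ^ n ≤ J := by
  refine Ideal.exists_pow_le_of_le_radical_of_fg ?_ (IsNoetherian.noetherian _)
  rw [Ideal.radical_eq_sInf]
  refine le_sInf fun P hP => ?_
  have hK : Ring.KrullDimLE 1 R := Ring.krullDimLE_iff.2 (by simp [hdim])
  have hPm := Ring.krullDimLE_one_iff_of_noZeroDivisors.1 hK P
    (fun h => hJ (le_bot_iff.1 (h ▸ hP.1))) hP.2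
  exact (eq_maximalIdeal hPm).ge

theorem exists_smul_integralClosure_le_one [IsDomain R] [IsFractionRing R K]
    (hfin : Module.Finite R (integralClosure R K)) :
    ∃ s : R, s ≠ 0 ∧ ∀ z ∈ integralClosure R K, s • z ∈ (1 : Submodule R K) := by
  have hfg : (Subalgebra.toSubmodule (integralClosure R K)).FG := Module.Finite.iff_fg.1 hfin
  obtain ⟨t, ht⟩ := hfg
  obtain ⟨s, hs⟩ := IsLocalization.exist_integer_multiples_of_finset (nonZeroDivisors R) t
  refine ⟨s, nonZeroDivisors.coe_ne_zero s, fun z hz => ?_⟩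
  replace hz : z ∈ Submodule.span R (t : Set K) := ht ▸ hz
  induction hz using Submodule.span_induction with
  | mem x hx =>
    obtain ⟨r, hr⟩ := hs x hx
    exact Submodule.mem_one.2 ⟨r, hr⟩
  | zero => simp
  | add x y _ _ hx hy => rw [smul_add]; exact add_mem hx hy
  | smul c x _ hx => rw [smul_comm]; exact Submodule.smul_mem _ c hx

theorem IsCanonicalModule.div_div_eq [IsDomain R] [IsNoetherianRing R] [IsFractionRing R K]
    (hdim : ringKrullDim R = 1) (hfin : Module.Finite R (integralClosure R K))
    {ω : Submodule R K} (hω : IsCanonicalModule R ω) (hRω : 1 ≤ ω)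
    (hωR : ω ≤ Subalgebra.toSubmodule (integralClosure R K))
    {A : Submodule R K} (hA0 : A ≠ ⊥) (hA : A ≤ Subalgebra.toSubmodule (integralClosure R K)) :
    ω / (ω / A) = A := by
  obtain ⟨s, hs0, hs⟩ := exists_smul_integralClosure_le_one hfin
  obtain ⟨a, ha, ha0⟩ := A.exists_mem_ne_zero_of_ne_bot hA0
  obtain ⟨x, hx⟩ := Submodule.mem_one.1 (hs a (hA ha))
  have hsK : algebraMap R K s ≠ 0 := by simpa using hs0
  have hx0 : x ≠ 0 := by
    rintro rfl
    rw [map_zero, Algebra.smul_def] at hx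
    exact mul_ne_zero hsK ha0 hx.symm
  have hxA : algebraMap R K x ∈ A := hx ▸ A.smul_mem s ha
  have hsxK : algebraMap R K (s * x) ≠ 0 := by simpa using ⟨hs0, hx0⟩
  have : IsNoetherian R (Subalgebra.toSubmodule (integralClosure R K)) :=
    isNoetherian_of_isNoetherianRing_of_finite R (integralClosure R K)
  have : IsNoetherian R A := isNoetherian_of_le hA
  have mem_iff : ∀ z, z ∈ Submodule.span R {algebraMap R K (s * x)} * ω ↔
      ∃ w ∈ ω, algebraMap R K (s * x) * w = z := fun z => Submodule.mem_span_singleton_mul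
  -- The climb starts at `sxω`: `sω ⊆ R` and `x ∈ A` put it inside `A`, and `s(sx)` multiplies `A`
  -- into it because `sA ⊆ R ⊆ ω`.
  refine hω.div_div_eq_of_le hdim (A := Submodule.span R {algebraMap R K (s * x)} * ω) ?_ ?_ ?_
  · intro z hz
    obtain ⟨w, hw, rfl⟩ := (mem_iff z).1 hz
    obtain ⟨r, hr⟩ := Submodule.mem_one.1 (hs w (hωR hw))
    have : algebraMap R K (s * x) * w = r • algebraMap R K x := by
      rw [Algebra.smul_def, hr, Algebra.smul_def, map_mul]
      ring
    rw [this]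
    exact A.smul_mem r hxA
  · obtain ⟨n, hn⟩ := exists_maximalIdeal_pow_le_of_ne_bot hdim
      (J := Ideal.span {s * (s * x)}) (by simp [hs0, hx0])
    refine ⟨n, fun c hc z hz => (mem_iff _).2 ?_⟩
    obtain ⟨d, rfl⟩ := Ideal.mem_span_singleton'.1 (hn hc)
    refine ⟨d • s • z, ω.smul_mem d (hRω (hs z (hA hz))), ?_⟩
    simp only [Algebra.smul_def, map_mul]
    ring
  · refine le_antisymm (fun z hz => ?_) (Submodule.le_div_div _ _)
    have hinv : (algebraMap R K (s * x))⁻¹ ∈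
        ω / (Submodule.span R {algebraMap R K (s * x)} * ω) := by
      rw [Submodule.mem_div_iff_forall_mul_mem]
      intro y hy
      obtain ⟨w, hw, rfl⟩ := (mem_iff y).1 hy
      rwa [inv_mul_cancel_left₀ hsxK]
    exact (mem_iff z).2 ⟨_, Submodule.mem_div_iff_forall_mul_mem.1 hz _ hinv,
      by rw [mul_comm z, mul_inv_cancel_left₀ hsxK]⟩

end Duality

/-! ### Reductions and the blowing-up. -/

section Reduction

open IsLocalization (coeSubmodule)

variable {R K : Type*} [CommRing R] [Field K] [Algebra R K]

theorem coeSubmodule_pow_add (I : Ideal R) (m n : ℕ) :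
    coeSubmodule K (I ^ (m + n)) = coeSubmodule K (I ^ m) * coeSubmodule K (I ^ n) := by
  rw [pow_add, IsLocalization.coeSubmodule_mul]

theorem algebraMap_pow_mem_coeSubmodule {I : Ideal R} {x : R} (hx : x ∈ I) (n : ℕ) :
    algebraMap R K x ^ n ∈ coeSubmodule K (I ^ n) :=
  (IsLocalization.mem_coeSubmodule K _).2 ⟨x ^ n, Ideal.pow_mem_pow hx n, map_pow _ _ _⟩

theorem coeSubmodule_pow_add_of_reduction {I : Ideal R} {x : R} {ν : ℕ}
    (hred : ∀ n ≥ ν, I ^ (n + 1) = Ideal.span {x} * I ^ n) {n : ℕ} (hn : ν ≤ n) (j : ℕ) :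
    coeSubmodule K (I ^ (n + j)) =
      Submodule.span R {algebraMap R K x ^ j} * coeSubmodule K (I ^ n) := by
  rw [← map_pow, ← IsLocalization.coeSubmodule_span_singleton, ← IsLocalization.coeSubmodule_mul]
  congr 1
  induction j with
  | zero => simp
  | succ j ih =>
    rw [← add_assoc, hred _ (by omega), ih, ← mul_assoc, Ideal.span_singleton_mul_span_singleton,
      ← pow_succ']

theorem one_le_blowup (I : Ideal R) : 1 ≤ blowup K I :=
  Submodule.one_le.2 ((mem_blowup_iff K I 1).2 ⟨0, by simp⟩)

variable [IsFractionRing R K]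

/-- An element of `I` of minimal value in the integral closure is a reduction of `I`. -/
theorem exists_pow_succ_eq_span_mul [IsDomain R] [IsNoetherianRing R]
    (hfin : Module.Finite R (integralClosure R K))
    [IsDiscreteValuationRing (integralClosure R K)] (I : Ideal R) :
    ∃ m, ∃ x ∈ I, ∀ n ≥ m, I ^ (n + 1) = Ideal.span {x} * I ^ n := by
  by_cases hI : I = ⊥
  · exact ⟨0, 0, I.zero_mem, fun n _ => by simp [hI]⟩
  let S := integralClosure R K
  have hinj : Function.Injective (algebraMap R S) := FaithfulSMul.algebraMap_injective R S
  obtain ⟨x, hxI, hmin⟩ := exists_minimalFor_of_wellFoundedLT (fun y => y ∈ I)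
    (fun y => IsDiscreteValuationRing.addVal S (algebraMap R S y)) ⟨0, I.zero_mem⟩
  have hdvd : ∀ y ∈ I, algebraMap R S x ∣ algebraMap R S y := fun y hy =>
    IsDiscreteValuationRing.addVal_le_iff_dvd.1 ((le_total _ _).elim id (hmin hy))
  have hX : algebraMap R S x ≠ 0 := by
    intro h
    refine hI (eq_bot_iff.2 fun y hy => hinj ?_)
    rw [map_zero, ← zero_dvd_iff, ← h]
    exact hdvd y hy
  have hpow : ∀ n, ∀ y ∈ I ^ n, algebraMap R S x ^ n ∣ algebraMap R S y := by
    intro n y hy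
    have h : (I ^ n).map (algebraMap R S) ≤ Ideal.span {algebraMap R S x ^ n} := by
      have h1 : I.map (algebraMap R S) ≤ Ideal.span {algebraMap R S x} :=
        Ideal.map_le_iff_le_comap.2 fun z hz =>
          Ideal.mem_comap.2 (Ideal.mem_span_singleton.2 (hdvd z hz))
      rw [Ideal.map_pow, ← Ideal.span_singleton_pow]
      exact Ideal.pow_right_mono h1 n
    exact Ideal.mem_span_singleton.1 (h (Ideal.mem_map_of_mem _ hy))
  -- `c n` is `x⁻ⁿIⁿ`, an ascending chain in a Noetherian module; `c (n + 1) = c n` means `Iⁿ⁺¹ =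
  -- xIⁿ`.
  let c : ℕ → Submodule R S := fun n =>
    (coeSubmodule S (I ^ n)).comap (LinearMap.mulLeft R (algebraMap R S x ^ n))
  have hc : Monotone c := by
    refine monotone_nat_of_le_succ fun n z hz => ?_
    obtain ⟨r, hr, hrz⟩ := (IsLocalization.mem_coeSubmodule S _).1 hz
    refine (IsLocalization.mem_coeSubmodule S _).2 ⟨x * r, ?_, ?_⟩
    · rw [pow_succ']
      exact Ideal.mul_mem_mul hxI hr
    · rw [map_mul, hrz, LinearMap.mulLeft_apply, LinearMap.mulLeft_apply, pow_succ', mul_assoc]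
  have : IsNoetherian R S := isNoetherian_of_isNoetherianRing_of_finite R S
  obtain ⟨m, hm⟩ := monotone_stabilizes_iff_noetherian.2 this ⟨c, hc⟩
  refine ⟨m, x, hxI, fun n hn => le_antisymm (fun y hy => ?_) ?_⟩
  · obtain ⟨z, hz⟩ := hpow _ y hy
    have hzc : z ∈ c (n + 1) := (IsLocalization.mem_coeSubmodule S _).2 ⟨y, hy, hz⟩
    have hcc : c (n + 1) = c n := (hm (n + 1) (by omega)).symm.trans (hm n hn)
    rw [hcc] at hzc
    obtain ⟨r, hr, hrz⟩ := (IsLocalization.mem_coeSubmodule S _).1 hzc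
    refine Ideal.mem_span_singleton_mul.2 ⟨r, hr, hinj ?_⟩
    rw [map_mul, hrz, hz, LinearMap.mulLeft_apply, pow_succ', mul_assoc]
  · rw [pow_succ']
    exact Ideal.mul_mono_left (by simpa using hxI)

variable {I : Ideal R} {x : R} {ν : ℕ}

theorem pow_mul_mem_coeSubmodule_of_reduction (hx0 : x ≠ 0)
    (hred : ∀ n ≥ ν, I ^ (n + 1) = Ideal.span {x} * I ^ n) {n j : ℕ} (hn : ν ≤ n) {z : K}
    (hz : algebraMap R K x ^ j * z ∈ coeSubmodule K (I ^ (n + j))) :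
    z ∈ coeSubmodule K (I ^ n) := by
  have hX : algebraMap R K x ^ j ≠ 0 := pow_ne_zero j (by simpa using hx0)
  rw [coeSubmodule_pow_add_of_reduction hred hn, Submodule.mem_span_singleton_mul] at hz
  obtain ⟨w, hw, h⟩ := hz
  rwa [← mul_left_cancel₀ hX h]

/-- Both directions multiply into a higher power of `I` and cancel a power of `x`. -/
theorem mem_blowup_iff_of_reduction (hx : x ∈ I) (hx0 : x ≠ 0)
    (hred : ∀ n ≥ ν, I ^ (n + 1) = Ideal.span {x} * I ^ n) {n : ℕ} (hn : ν ≤ n) {z : K} :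
    z ∈ blowup K I ↔ algebraMap R K x ^ n * z ∈ coeSubmodule K (I ^ n) := by
  rw [mem_blowup_iff]
  constructor
  · rintro ⟨k, hk⟩
    refine pow_mul_mem_coeSubmodule_of_reduction (j := k) hx0 hred hn ?_
    rw [coeSubmodule_pow_add, mul_left_comm, mul_comm _ z]
    exact Submodule.mul_mem_mul (algebraMap_pow_mem_coeSubmodule hx n)
      (Submodule.mem_div_iff_forall_mul_mem.1 hk _ (algebraMap_pow_mem_coeSubmodule hx k))
  · refine fun h => ⟨n, Submodule.mem_div_iff_forall_mul_mem.2 fun y hy => ?_⟩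
    refine pow_mul_mem_coeSubmodule_of_reduction (j := n) hx0 hred hn ?_
    rw [coeSubmodule_pow_add, ← mul_assoc]
    exact Submodule.mul_mem_mul h hy

theorem coeSubmodule_pow_eq_span_mul_blowup (hx : x ∈ I) (hx0 : x ≠ 0)
    (hred : ∀ n ≥ ν, I ^ (n + 1) = Ideal.span {x} * I ^ n) {n : ℕ} (hn : ν ≤ n) :
    coeSubmodule K (I ^ n) = Submodule.span R {algebraMap R K x ^ n} * blowup K I := by
  have hX : algebraMap R K x ^ n ≠ 0 := pow_ne_zero n (by simpa using hx0)
  ext z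
  rw [Submodule.mem_span_singleton_mul]
  constructor
  · refine fun hz => ⟨(algebraMap R K x ^ n)⁻¹ * z, ?_, mul_inv_cancel_left₀ hX z⟩
    rwa [mem_blowup_iff_of_reduction hx hx0 hred hn, mul_inv_cancel_left₀ hX]
  · rintro ⟨w, hw, rfl⟩
    exact (mem_blowup_iff_of_reduction hx hx0 hred hn).1 hw

theorem blowup_mul_self (hx : x ∈ I) (hx0 : x ≠ 0)
    (hred : ∀ n ≥ ν, I ^ (n + 1) = Ideal.span {x} * I ^ n) :
    blowup K I * blowup K I ≤ blowup K I := by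
  refine Submodule.mul_le.2 fun z hz w hw => ?_
  rw [mem_blowup_iff_of_reduction hx hx0 hred le_rfl] at hz hw ⊢
  refine pow_mul_mem_coeSubmodule_of_reduction (j := ν) hx0 hred le_rfl ?_
  rw [coeSubmodule_pow_add, show ∀ a : K, a * (a * (z * w)) = (a * z) * (a * w) by intro a; ring]
  exact Submodule.mul_mem_mul hz hw

theorem blowup_le_integralClosure [IsDomain R] [IsNoetherianRing R] (hI : I ≠ ⊥) :
    blowup K I ≤ Subalgebra.toSubmodule (integralClosure R K) := by
  intro z hz
  obtain ⟨n, hn⟩ := (mem_blowup_iff K I z).1 hz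
  refine isIntegral_of_smul_mem_submodule (coeSubmodule K (I ^ n)) (fun h => ?_)
    ((IsLocalization.coeSubmodule_fg K (IsFractionRing.injective R K) _).2
      (IsNoetherian.noetherian _)) z (Submodule.mem_div_iff_forall_mul_mem.1 hn)
  rw [← IsLocalization.coeSubmodule_bot] at h
  exact pow_ne_zero n hI (IsFractionRing.coeSubmodule_injective R K h)

end Reduction

/-! ### The equivalences. -/

theorem proposition2p1 {R K : Type u} [CommRing R] [IsDomain R] [IsLocalRing R]
    [IsNoetherianRing R] (hdim : ringKrullDim R = 1) (hk : Infinite (IsLocalRing.ResidueField R))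
    [Field K] [Algebra R K] [IsFractionRing R K]
    (hfin : Module.Finite R (integralClosure R K))
    [IsDiscreteValuationRing (integralClosure R K)]
    (hres : IsResiduallyRational R (integralClosure R K))
    (ω : Submodule R K) (hω : IsCanonicalModule R ω)
    (hRω : 1 ≤ ω) (hωR : ω ≤ Subalgebra.toSubmodule (integralClosure R K))
    (I : Ideal R) (hI : I.IsPrimary) (hrad : I.radical = IsLocalRing.maximalIdeal R)
    (hnp : ¬ I.IsPrincipal)
    (Λ : Submodule R K) (hΛ : Λ = blowup K I) (ν : ℕ) (hν : ν = reductionExponent I) :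
    -- the conditions (A) are equivalent
    [ω ≤ Λ,
      ω * Λ = Λ,
      ω / Λ = 1 / Λ,
      ∀ n ≥ ν, I ^ n = canonicalClosure K ω (I ^ n),
      ∀ n ≥ ν, ω * IsLocalization.coeSubmodule K (I ^ n) =
        IsLocalization.coeSubmodule K (I ^ n),
      ∃ n > 0, ω * IsLocalization.coeSubmodule K (I ^ n) =
        IsLocalization.coeSubmodule K (I ^ n)].TFAE ∧
    -- the conditions (B) are equivalent
    (Λ = 1 / (1 / Λ) ↔ ω / Λ = ω * (1 / Λ)) ∧
    -- (A) holds if and only if (B) holds and `R : Λ ⊆ R : ω`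
    (ω ≤ Λ ↔ (Λ = 1 / (1 / Λ) ∧ ω / Λ = ω * (1 / Λ)) ∧ 1 / Λ ≤ 1 / ω) := by
  have hI0 : I ≠ ⊥ := by
    rintro rfl
    refine maximalIdeal_ne_bot_of_ringKrullDim_eq_one hdim ?_
    rw [← hrad, Ideal.radical_bot_of_isReduced]
  obtain ⟨x, hxI, hred⟩ : ∃ x ∈ I, ∀ n ≥ ν, I ^ (n + 1) = Ideal.span {x} * I ^ n :=
    hν ▸ Nat.sInf_mem (exists_pow_succ_eq_span_mul (K := K) hfin I)
  have hx0 : x ≠ 0 := by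
    rintro rfl
    have h := hred ν le_rfl
    rw [Ideal.span_singleton_zero, Ideal.bot_mul] at h
    exact pow_ne_zero _ hI0 h
  have hxm : x ∈ IsLocalRing.maximalIdeal R := hrad ▸ Ideal.le_radical hxI
  obtain ⟨s, hs0, hs⟩ := exists_smul_integralClosure_le_one hfin
  have hdual : ∀ A : Submodule R K, A ≠ ⊥ → A ≤ Subalgebra.toSubmodule (integralClosure R K) →
      ω / (ω / A) = A := fun A => hω.div_div_eq hdim hfin hRω hωR
  have hωω : ω / ω = 1 := by
    have h := hdual 1 one_ne_zero (hRω.trans hωR)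
    rwa [show ω / 1 = ω from eq_of_forall_le_iff fun D => by
      rw [Submodule.le_div_iff_mul_le, mul_one]] at h
  have h1Λ : 1 ≤ Λ := hΛ ▸ one_le_blowup I
  have hΛΛ : Λ * Λ ≤ Λ := hΛ ▸ blowup_mul_self hxI hx0 hred
  have hΛR : Λ ≤ Subalgebra.toSubmodule (integralClosure R K) :=
    hΛ ▸ blowup_le_integralClosure hI0
  have hΛmem : ∀ n ≥ ν, ∀ z, z ∈ Λ ↔
      algebraMap R K x ^ n * z ∈ IsLocalization.coeSubmodule K (I ^ n) := fun n hn z =>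
    hΛ ▸ mem_blowup_iff_of_reduction hxI hx0 hred hn
  have hpow : ∀ n ≥ ν, IsLocalization.coeSubmodule K (I ^ n) =
      Submodule.span R {algebraMap R K x ^ n} * Λ := fun n hn =>
    hΛ ▸ coeSubmodule_pow_eq_span_mul_blowup hxI hx0 hred hn
  have hΛdual : ω / (ω / Λ) = Λ := hdual Λ (fun h => one_ne_zero (le_bot_iff.1 (h ▸ h1Λ))) hΛR
  have hdiv : ∀ A : Submodule R K, ω / (ω * A) = 1 / A := fun A => by
    rw [Submodule.div_mul_eq_div_div, hωω]
  have h1Λ1 : 1 / Λ ≤ 1 := fun z hz => by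
    simpa using Submodule.mem_div_iff_forall_mul_mem.1 hz 1 (Submodule.one_le.1 h1Λ)
  have h12 : ω ≤ Λ → ω * Λ = Λ := fun h =>
    le_antisymm ((mul_le_mul' h le_rfl).trans hΛΛ) (by
      simpa using mul_le_mul' hRω (le_refl Λ))
  have h21 : ω * Λ = Λ → ω ≤ Λ := fun h => by
    rw [← h]
    simpa using mul_le_mul' (le_refl ω) h1Λ
  -- The two sides are `ω`-duals of each other: `R : (R : Λ) = ω : ω(R : Λ)`.
  have hB : Λ = 1 / (1 / Λ) ↔ ω / Λ = ω * (1 / Λ) := by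
    have hne : ω * (1 / Λ) ≠ ⊥ := by
      refine (Submodule.ne_bot_iff _).2 ⟨1 * algebraMap R K s, Submodule.mul_mem_mul
        (Submodule.one_le.1 hRω) (Submodule.mem_div_iff_forall_mul_mem.2 fun y hy => ?_), ?_⟩
      · rw [← Algebra.smul_def]
        exact hs y (hΛR hy)
      · simpa using hs0
    have hle : ω * (1 / Λ) ≤ Subalgebra.toSubmodule (integralClosure R K) :=
      (mul_le_mul' le_rfl h1Λ1).trans (by simpa using hωR)
    constructor
    · intro h
      conv_lhs => rw [h, ← hdiv, hdual _ hne hle]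
    · intro h
      rw [← hdiv, ← h, hΛdual]
  have h23 : ω * Λ = Λ → ω / Λ = 1 / Λ := fun h => by rw [← hdiv, h]
  refine ⟨?_, hB, ?_⟩
  · tfae_have 1 → 2 := h12
    tfae_have 2 → 1 := h21
    tfae_have 2 → 3 := h23
    tfae_have 3 → 1 := by
      intro h
      rw [← hΛdual, h, Submodule.le_div_iff_mul_le]
      exact (mul_le_mul' le_rfl h1Λ1).trans (mul_one ω).le
    tfae_have 2 → 5 := by
      intro h n hn
      rw [hpow n hn, mul_left_comm, h]
    -- `ν` itself may be `0`.
    tfae_have 5 → 6 := fun h => ⟨ν + 1, by omega, h _ (by omega)⟩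
    tfae_have 6 → 1 := by
      rintro ⟨n, hn0, hn⟩ z hz
      -- `n` may be below `ν`; multiplying by `Iⁿᵛ` keeps the power `ω`-stable and passes `ν`.
      have hN : ν ≤ n + n * ν := le_add_left (Nat.le_mul_of_pos_left ν hn0)
      rw [hΛmem _ hN, coeSubmodule_pow_add, ← hn, mul_assoc, ← coeSubmodule_pow_add,
        mul_comm (algebraMap R K x ^ _)]
      exact Submodule.mul_mem_mul hz (algebraMap_pow_mem_coeSubmodule hxI _)
    tfae_have 5 → 4 := by
      intro h n hn
      ext r
      rw [canonicalClosure, mul_comm, h n hn, Submodule.mem_comap]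
      exact ⟨fun hr => Submodule.mem_map_of_mem hr, fun hr => by
        obtain ⟨t, ht, htr⟩ := (IsLocalization.mem_coeSubmodule K _).1 hr
        rwa [← IsFractionRing.injective R K htr]⟩
    tfae_have 4 → 1 := by
      intro h z hz
      -- A high power of `x` lies in `sR`, so it carries `z` into `R`, hence into the canonical
      -- closure of that power of `I`.
      obtain ⟨N, hN⟩ := exists_maximalIdeal_pow_le_of_ne_bot hdim (J := Ideal.span {s})
        (by simpa using hs0)
      obtain ⟨c, hc⟩ := Ideal.mem_span_singleton'.1
        (hN (Ideal.pow_le_pow_right (le_max_right ν N) (Ideal.pow_mem_pow hxm (max ν N))))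
      obtain ⟨r, hr⟩ := Submodule.mem_one.1 (hs z (hωR hz))
      have hcr : algebraMap R K (c * r) = algebraMap R K x ^ max ν N * z := by
        rw [← map_pow, ← hc, map_mul, map_mul, hr, Algebra.smul_def, mul_assoc]
      rw [hΛmem _ (le_max_left ν N), ← hcr]
      refine Submodule.mem_map_of_mem (f := Algebra.linearMap R K) ?_
      rw [h _ (le_max_left ν N), canonicalClosure, Submodule.mem_comap, Algebra.linearMap_apply, hcr]
      exact Submodule.mul_mem_mul (algebraMap_pow_mem_coeSubmodule hxI _) hz
    tfae_finish
  · constructor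
    · intro h
      have hB2 : ω / Λ = ω * (1 / Λ) := by
        rw [h23 (h12 h)]
        refine le_antisymm (by simpa using mul_le_mul' hRω (le_refl (1 / Λ))) ?_
        rw [Submodule.le_div_iff_mul_le, mul_comm ω, mul_assoc, h12 h,
          ← Submodule.le_div_iff_mul_le]
      exact ⟨⟨hB.2 hB2, hB2⟩, Submodule.div_anti 1 h⟩
    · rintro ⟨⟨h, -⟩, hle⟩
      rw [h]
      -- `ω ⊆ R : (R : ω) ⊆ R : (R : Λ)`.
      exact (Submodule.le_div_div 1 ω).trans (Submodule.div_anti 1 hle)
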